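/- Let $D$ be a one-dimensional Prüfer domain with quotient field $K$, i.e., an integral domain of Krull dimension $1$ such that the localization $D_P$ is a valuation domain for every prime ideal $P$ of $D$. For a domain $T$ with $D\subseteq T\subseteq K$, let $\mathrm{Inv}(T)$ denote the abelian group of invertible fractional ideals of $T$ under multiplication. For a set $Y\subseteq\mathrm{Max}(D)$ of maximal ideals of $D$, let $\Theta(Y):=\bigcap\{D_P\mid P\in Y\}\subseteq K$, with $\Theta(\emptyset):=K$. Let $\mathrm{Max}(D)^{\mathrm{inv}}$ be the set of maximal ideals of $D$ with the inverse topology, i.e., the topology having as a basis of open sets the sets $\{P\in\mathrm{Max}(D)\mid I\subseteq P\}$ with $I$ ranging among the finitely generated ideals of $D$. Let $\{A_n\}$ be a countable family of clopen subsets of $\mathrm{Max}(D)^{\mathrm{inv}}$, and let $A:=\bigcup_n A_n$. If the group $\mathrm{Inv}(\Theta(A_n))$ is free (as an abelian group) for every $n$, then the kernel of the extension homomorphism $$\mathrm{Inv}(D)\longrightarrow\mathrm{Inv}(\Theta(\mathrm{Max}(D)\setminus A)),\qquad I\longmapsto I\,\Theta(\mathrm{Max}(D)\setminus A),$$ is a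 free abelian group. -/

import Mathlib

open scoped nonZeroDivisors

/-- The group `Inv(D)` of invertible fractional ideals of a domain `D` with quotient field `K`
(written multiplicatively). -/
abbrev InvGroup (D K : Type*) [CommRing D] [Field K] [Algebra D K] : Type _ :=
  (FractionalIdeal D⁰ K)ˣ

/-- A commutative group, written multiplicatively, is free (as an abelian group). -/
def IsFreeAbelian (G : Type*) [CommGroup G] : Prop :=
  Module.Free ℤ (Additive G)

/-- A Prüfer domain: an integral domain all of whose localizations at prime ideals are valuation
domains. -/
def IsPruferDomain (D : Type*) [CommRing D] [IsDomain D] : Prop :=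
  ∀ P : PrimeSpectrum D, ValuationRing (Localization.AtPrime P.asIdeal)

/-- The inverse topology on `Spec(D)`: the sets `V(I)`, with `I` a finitely generated ideal, are
a basis of open sets. -/
abbrev inverseTopology (D : Type*) [CommRing D] : TopologicalSpace (PrimeSpectrum D) :=
  TopologicalSpace.generateFrom
    {U | ∃ I : Ideal D, I.FG ∧ U = PrimeSpectrum.zeroLocus (I : Set D)}

/-- The inverse topology on `Max(D)`: the subspace topology induced by `Spec(D)` with the inverse
topology. -/
abbrev maxInverseTopology (D : Type*) [CommRing D] : TopologicalSpace (MaximalSpectrum D) :=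
  TopologicalSpace.induced MaximalSpectrum.toPrimeSpectrum (inverseTopology D)

/-- `Θ(Y) = ⋂ {D_P ∣ P ∈ Y}`, as a ring between `D` and its quotient field `K`, for a set `Y` of
prime ideals of `D`; here `D_P ⊆ K` is the set of fractions `a / s` with `s ∉ P`. For `Y = ∅` this
is `K`. -/
noncomputable def thetaRing (D K : Type*) [CommRing D] [IsDomain D] [Field K] [Algebra D K]
    [IsFractionRing D K] (Y : Set (PrimeSpectrum D)) : Subalgebra D K :=
  ⨅ P ∈ Y, Localization.subalgebra.ofField K P.asIdeal.primeCompl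
    P.asIdeal.primeCompl_le_nonZeroDivisors

/-- `Θ(Y)` for a set `Y` of maximal ideals of `D`. -/
noncomputable def thetaMax (D K : Type*) [CommRing D] [IsDomain D] [Field K] [Algebra D K]
    [IsFractionRing D K] (Y : Set (MaximalSpectrum D)) : Subalgebra D K :=
  thetaRing D K (MaximalSpectrum.toPrimeSpectrum '' Y)

/-- The extension homomorphism `Inv(D) → Inv(T)`, `I ↦ IT`, for an overring `T` of `D`. -/
noncomputable def invExtension (D K : Type*) [CommRing D] [IsDomain D] [Field K] [Algebra D K]
    [IsFractionRing D K] (T : Subalgebra D K) : InvGroup D K →* InvGroup T K :=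
  Units.map (FractionalIdeal.extendedHom (A := D) (K := K) K T).toMonoidHom

/-!
For `Y ⊆ Max(D)` an invertible ideal `I` extends to the trivial ideal of `Θ(Y)` if and only if
`I` and `I⁻¹` are contained in `D_P` for all `P ∈ Y`, that is, `I` is trivial at every `P ∈ Y`
(`mem_ker_invExtension_iff`). Write `H(B)` for the group of invertible ideals that are trivial off
`B`, the kernel of the extension map to `Θ(Max(D) \ B)`. An ideal that is trivial at all maximal
ideals is trivial, so for `B ⊆ A` the extension map embeds `H(B)` into `Inv(Θ(A))`. When the latter
is free so is `H(B)`, since subgroups of free abelian groups are free (`Submodule.free_of_pid`).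

If `B` is clopen in the inverse topology, then `Inv(D)` is the product of `H(B)` and `H(Bᶜ)`
(`IsPruferDomain.ker_sup_ker_compl_eq_top`). By the Prüfer property every invertible ideal is a
quotient of integral ones, and for a nonzero finitely generated ideal `I` the set of maximal ideals
containing `I` is compact and open, so the parts of it inside and outside `B` are cut out by finitely
generated ideals `L` and `L'`. In dimension one some power of `L L'` lies in `I`, and
`I + L ^ n` is the component of `I` in `H(B)`.

Finally, after replacing the given family by a disjoint sequence of clopen sets `B n` with the same
union, each contained in a member of the family, compactness and the splitting show that the
kernel in question is the direct sum of the groups `H(B n)`, each of which is free.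
-/

/-! ### Free modules over a principal ideal domain -/

/-- A family of finitely supported functions with nonzero leading coefficients at pairwise different
positions is linearly independent. -/
theorem Finsupp.linearIndependent_of_leadingCoeff {R ι : Type*} [CommRing R] [IsDomain R]
    [LinearOrder ι] {s : Set ι} (v : s → ι →₀ R) (hlead : ∀ i, v i i ≠ 0)
    (hgt : ∀ (i : s) (j : ι), (i : ι) < j → v i j = 0) : LinearIndependent R v := by
  rw [linearIndependent_iff]
  intro l hl
  by_contra hne
  have hsupp : l.support.Nonempty := Finsupp.support_nonempty_iff.mpr hne
  have h := DFunLike.congr_fun hl (l.support.max' hsupp : ι)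
  rw [Finsupp.linearCombination_apply, Finsupp.sum, Finsupp.finsetSum_apply,
    Finset.sum_eq_single (l.support.max' hsupp)] at h
  · have hmem := l.support.max'_mem hsupp
    rw [Finsupp.mem_support_iff] at hmem
    exact mul_ne_zero hmem (hlead _) h
  · intro j hj hne
    have hlt : j < l.support.max' hsupp := lt_of_le_of_ne (l.support.le_max' j hj) hne
    simp [hgt j _ hlt]
  · intro h
    exact absurd (l.support.max'_mem hsupp) h

/-- The leading coefficients at position `i` of the elements of `N` supported on `Set.Iic i`
form an ideal; this is a principal generator together with an element realizing it. -/
theorem Finsupp.exists_leading_generator {R ι : Type*} [CommRing R] [IsDomain R]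
    [IsPrincipalIdealRing R] [LinearOrder ι] (N : Submodule R (ι →₀ R)) (i : ι) :
    ∃ f ∈ N, (∀ j, i < j → f j = 0) ∧
      ∀ g ∈ N, (∀ j, i < j → g j = 0) → ∃ c : R, g i = c * f i := by
  let N' : Submodule R (ι →₀ R) := N ⊓ ⨅ j ∈ Set.Ioi i, LinearMap.ker (Finsupp.lapply j)
  have hN' : ∀ g, g ∈ N' ↔ g ∈ N ∧ ∀ j, i < j → g j = 0 := by
    intro g
    simp [N', Submodule.mem_iInf]
  obtain ⟨a, ha⟩ := IsPrincipalIdealRing.principal (N'.map (Finsupp.lapply i))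
  have hmem : a ∈ N'.map (Finsupp.lapply i) := by
    rw [ha]
    exact Submodule.mem_span_singleton_self a
  obtain ⟨f, hf, rfl⟩ := hmem
  refine ⟨f, ((hN' f).mp hf).1, ((hN' f).mp hf).2, fun g hg hgt => ?_⟩
  have hgi : g i ∈ N'.map (Finsupp.lapply i) := ⟨g, (hN' g).mpr ⟨hg, hgt⟩, rfl⟩
  rw [ha, Submodule.mem_span_singleton] at hgi
  obtain ⟨c, hc⟩ := hgi
  exact ⟨c, hc.symm⟩

/-- A submodule of a free module, of arbitrary rank, over a principal ideal domain is free: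
after well-ordering a basis, elements realizing generators of the ideals of leading coefficients
form a basis of the submodule. -/
theorem Submodule.free_of_pid {R M : Type*} [CommRing R] [IsDomain R] [IsPrincipalIdealRing R]
    [AddCommGroup M] [Module R M] [Module.Free R M] (N : Submodule R M) : Module.Free R N := by
  let ι := Module.Free.ChooseBasisIndex R M
  let e : M ≃ₗ[R] (ι →₀ R) := (Module.Free.chooseBasis R M).repr
  obtain ⟨_, hwf⟩ := exists_wellFoundedLT (α := ι)
  let N' : Submodule R (ι →₀ R) := N.map e.toLinearMap
  suffices Module.Free R N' from Module.Free.of_equiv (e.submoduleMap N).symm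
  choose f hfN hfgt hfgen using Finsupp.exists_leading_generator N'
  let s : Set ι := {i | f i i ≠ 0}
  have hli : LinearIndependent R fun i : s => f i :=
    Finsupp.linearIndependent_of_leadingCoeff _ (fun i => i.2) fun i => hfgt i
  have hspan : ∀ i, ∀ g ∈ N', (∀ j, i < j → g j = 0) →
      g ∈ Submodule.span R (Set.range fun i : s => f i) := by
    intro i
    induction i using hwf.wf.induction with
    | _ i ih =>
      -- An element of `N'` supported below `i` is handled by induction.
      have hlow : ∀ g ∈ N', (∀ j, i ≤ j → g j = 0) →
          g ∈ Submodule.span R (Set.range fun i : s => f i) := by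
        intro g hg hgi
        by_cases hg0 : g = 0
        · rw [hg0]
          exact Submodule.zero_mem _
        have hsupp : g.support.Nonempty := Finsupp.support_nonempty_iff.mpr hg0
        have hm := g.support.max'_mem hsupp
        rw [Finsupp.mem_support_iff] at hm
        refine ih (g.support.max' hsupp) (lt_of_not_ge fun hle => hm (hgi _ hle)) g hg fun j hj => ?_
        by_contra hgj
        exact absurd (g.support.le_max' j (Finsupp.mem_support_iff.mpr hgj)) (not_le.mpr hj)
      intro g hg hgt
      obtain ⟨c, hc⟩ := hfgen i g hg hgt
      by_cases hi : f i i = 0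
      · refine hlow g hg fun j hj => ?_
        rcases hj.eq_or_lt with rfl | hj
        · rw [hc, hi, mul_zero]
        · exact hgt j hj
      · have hsub := hlow (g - c • f i) (N'.sub_mem hg (N'.smul_mem c (hfN i))) fun j hj => by
          rcases hj.eq_or_lt with rfl | hj
          · simp [hc]
          · simp [hgt j hj, hfgt i j hj]
        have hfi : f i ∈ Submodule.span R (Set.range fun i : s => f i) :=
          Submodule.subset_span ⟨⟨i, hi⟩, rfl⟩
        have := Submodule.add_mem _ hsub (Submodule.smul_mem _ c hfi)
        rwa [sub_add_cancel] at this
  have hN' : Submodule.span R (Set.range fun i : s => f i) = N' := by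
    refine le_antisymm (Submodule.span_le.mpr ?_) fun g hg => ?_
    · rintro _ ⟨i, rfl⟩
      exact hfN i
    · by_cases hg0 : g = 0
      · rw [hg0]
        exact Submodule.zero_mem _
      refine hspan (g.support.max' (Finsupp.support_nonempty_iff.mpr hg0)) g hg fun j hj => ?_
      by_contra hgj
      exact absurd (g.support.le_max' j (Finsupp.mem_support_iff.mpr hgj)) (not_le.mpr hj)
  rw [← hN']
  exact Module.Free.of_basis (Module.Basis.span hli)

/-! ### Free abelian groups, written multiplicatively -/

theorem IsFreeAbelian.of_injective {G H : Type*} [CommGroup G] [CommGroup H]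
    (hH : IsFreeAbelian H) (f : G →* H) (hf : Function.Injective f) : IsFreeAbelian G := by
  have : Module.Free ℤ (Additive H) := hH
  let g : Additive G →ₗ[ℤ] Additive H := (MonoidHom.toAdditive f).toIntLinearMap
  have hg : Function.Injective g := hf
  have := Submodule.free_of_pid (LinearMap.range g)
  exact Module.Free.of_equiv (LinearEquiv.ofInjective g hg).symm

theorem IsFreeAbelian.iSup_of_iSupIndep {G ι : Type*} [CommGroup G] {M : ι → Subgroup G}
    (hM : ∀ i, IsFreeAbelian (M i)) (hind : iSupIndep M) :
    IsFreeAbelian (⨆ i, M i : Subgroup G) := by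
  classical
  let e : Subgroup G ≃o Submodule ℤ (Additive G) :=
    Subgroup.toAddSubgroup.trans AddSubgroup.toIntSubmodule
  have he : ∀ H : Subgroup G, IsFreeAbelian H ↔ Module.Free ℤ (e H) := by
    intro H
    let φ : Additive H ≃+ e H :=
      { toFun := fun x => ⟨Additive.ofMul (x.toMul : G), x.toMul.2⟩
        invFun := fun x => Additive.ofMul ⟨x.1.toMul, x.2⟩
        left_inv := fun _ => rfl
        right_inv := fun _ => rfl
        map_add' := fun _ _ => rfl }
    exact ⟨fun h => have : Module.Free ℤ (Additive H) := h
        Module.Free.of_equiv φ.toIntLinearEquiv,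
      fun h => Module.Free.of_equiv φ.symm.toIntLinearEquiv⟩
  have hfree : ∀ i, Module.Free ℤ (e (M i)) := fun i => (he _).mp (hM i)
  have hind' : iSupIndep fun i => e (M i) := hind.map_orderIso e
  rw [he, e.map_iSup, Submodule.iSup_eq_range_dfinsupp_lsum]
  exact Module.Free.of_equiv (LinearEquiv.ofInjective _ hind'.dfinsupp_lsum_injective)

/-! ### The overrings `Θ(Y)` and the kernels of the extension maps -/

section Theta

variable {D K : Type*} [CommRing D] [IsDomain D] [Field K] [Algebra D K] [IsFractionRing D K]

theorem mem_thetaMax_iff {Y : Set (MaximalSpectrum D)} {x : K} :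
    x ∈ thetaMax D K Y ↔
      ∀ P ∈ Y, ∃ s ∉ P.asIdeal, ∃ a, algebraMap D K s * x = algebraMap D K a := by
  have hloc : ∀ P : MaximalSpectrum D, x ∈ Localization.subalgebra.ofField K
      P.toPrimeSpectrum.asIdeal.primeCompl
        P.toPrimeSpectrum.asIdeal.primeCompl_le_nonZeroDivisors ↔
      ∃ s ∉ P.asIdeal, ∃ a, algebraMap D K s * x = algebraMap D K a := by
    intro P
    have hne : ∀ s ∉ P.asIdeal, algebraMap D K s ≠ 0 := fun s hs h => hs <| by
      rw [(FaithfulSMul.algebraMap_eq_zero_iff D K).mp h]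
      exact P.asIdeal.zero_mem
    constructor
    · rintro ⟨a, s, hs, rfl⟩
      exact ⟨s, hs, a, by rw [mul_left_comm, mul_inv_cancel₀ (hne s hs), mul_one]⟩
    · rintro ⟨s, hs, a, h⟩
      exact ⟨a, s, hs, by rw [← h, mul_comm, inv_mul_cancel_left₀ (hne s hs)]⟩
  simp only [thetaMax, thetaRing, Algebra.mem_iInf, Set.forall_mem_image, hloc]

theorem thetaMax_anti {Y Z : Set (MaximalSpectrum D)} (h : Y ⊆ Z) :
    thetaMax D K Z ≤ thetaMax D K Y := fun _ hx =>
  mem_thetaMax_iff.mpr fun P hP => mem_thetaMax_iff.mp hx P (h hP)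

theorem mem_thetaMax_univ_iff {x : K} :
    x ∈ thetaMax D K Set.univ ↔ x ∈ (1 : FractionalIdeal D⁰ K) := by
  rw [FractionalIdeal.mem_one_iff, ← Set.mem_range, ← Algebra.mem_bot,
    ← MaximalSpectrum.iInf_localization_eq_bot]
  simp only [thetaMax, thetaRing, Algebra.mem_iInf, Set.forall_mem_image, Set.mem_univ,
    forall_const]
  rfl

/-- An invertible ideal `I` extends to the trivial ideal of `T` if and only if `I` and `I⁻¹` are
contained in `T`. -/
theorem mem_ker_invExtension_iff {T : Subalgebra D K} {u : InvGroup D K} :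
    u ∈ (invExtension D K T).ker ↔
      (∀ x ∈ (u : FractionalIdeal D⁰ K), x ∈ T) ∧
        ∀ x ∈ ((u⁻¹ : InvGroup D K) : FractionalIdeal D⁰ K), x ∈ T := by
  have hcoe : ∀ v : InvGroup D K,
      ((invExtension D K T v : FractionalIdeal T⁰ K) : Submodule T K) =
        Submodule.span T ((v : FractionalIdeal D⁰ K) : Set K) := by
    intro v
    have hT : D⁰ ≤ Submonoid.comap (algebraMap D T) T⁰ :=
      nonZeroDivisors_le_comap_nonZeroDivisors_of_injective _ (FaithfulSMul.algebraMap_injective _ _)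
    have hmap : IsLocalization.map K (algebraMap D T) hT = RingHom.id K :=
      IsLocalization.ringHom_ext D⁰ (by rw [IsLocalization.map_comp]; rfl)
    refine (FractionalIdeal.coe_extended_eq_span K hT (v : FractionalIdeal D⁰ K)).trans ?_
    rw [hmap, RingHom.coe_id, Set.image_id]
  have hle : ∀ v : InvGroup D K, (invExtension D K T v : FractionalIdeal T⁰ K) ≤ 1 ↔
      ∀ x ∈ (v : FractionalIdeal D⁰ K), x ∈ T := by
    intro v
    rw [← FractionalIdeal.coe_le_coe, hcoe, Submodule.span_le]
    refine forall₂_congr fun x _ => ?_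
    rw [SetLike.mem_coe, FractionalIdeal.mem_coe, FractionalIdeal.mem_one_iff]
    exact ⟨fun ⟨t, ht⟩ => ht ▸ t.2, fun hx => ⟨⟨x, hx⟩, rfl⟩⟩
  rw [← hle, ← hle, MonoidHom.mem_ker, map_inv]
  constructor
  · intro h
    simp [h]
  · rintro ⟨h₁, h₂⟩
    refine Units.ext (le_antisymm h₁ ?_)
    calc (1 : FractionalIdeal T⁰ K)
        = (invExtension D K T u : FractionalIdeal T⁰ K) *
            ((invExtension D K T u)⁻¹ : InvGroup T K) := (Units.mul_inv _).symm
      _ ≤ (invExtension D K T u : FractionalIdeal T⁰ K) * 1 := mul_le_mul_right h₂ _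
      _ = _ := mul_one _

theorem ker_invExtension_thetaMax_anti {Y Z : Set (MaximalSpectrum D)} (h : Y ⊆ Z) :
    (invExtension D K (thetaMax D K Z)).ker ≤ (invExtension D K (thetaMax D K Y)).ker := by
  intro u hu
  rw [mem_ker_invExtension_iff] at hu ⊢
  exact ⟨fun x hx => thetaMax_anti h (hu.1 x hx), fun x hx => thetaMax_anti h (hu.2 x hx)⟩

theorem ker_invExtension_thetaMax_inf_le (Y Z : Set (MaximalSpectrum D)) :
    (invExtension D K (thetaMax D K Y)).ker ⊓ (invExtension D K (thetaMax D K Z)).ker ≤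
      (invExtension D K (thetaMax D K (Y ∪ Z))).ker := by
  rintro u ⟨hY, hZ⟩
  replace hY := mem_ker_invExtension_iff.mp hY
  replace hZ := mem_ker_invExtension_iff.mp hZ
  have h : ∀ x : K, x ∈ thetaMax D K Y → x ∈ thetaMax D K Z → x ∈ thetaMax D K (Y ∪ Z) := by
    intro x hxY hxZ
    rw [mem_thetaMax_iff] at hxY hxZ ⊢
    exact fun P hP => hP.elim (hxY P) (hxZ P)
  rw [mem_ker_invExtension_iff]
  exact ⟨fun x hx => h x (hY.1 x hx) (hZ.1 x hx), fun x hx => h x (hY.2 x hx) (hZ.2 x hx)⟩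

/-- An invertible ideal that is trivial at all maximal ideals is trivial. -/
theorem ker_invExtension_thetaMax_univ :
    (invExtension D K (thetaMax D K Set.univ)).ker = ⊥ := by
  refine (Subgroup.eq_bot_iff_forall _).mpr fun u hu => ?_
  rw [mem_ker_invExtension_iff] at hu
  have h₁ : (u : FractionalIdeal D⁰ K) ≤ 1 := fun x hx => mem_thetaMax_univ_iff.mp (hu.1 x hx)
  have h₂ : ((u⁻¹ : InvGroup D K) : FractionalIdeal D⁰ K) ≤ 1 :=
    fun x hx => mem_thetaMax_univ_iff.mp (hu.2 x hx)
  refine Units.ext (le_antisymm h₁ ?_)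
  calc (1 : FractionalIdeal D⁰ K)
      = (u : FractionalIdeal D⁰ K) * ((u⁻¹ : InvGroup D K) : FractionalIdeal D⁰ K) :=
        (Units.mul_inv u).symm
    _ ≤ (u : FractionalIdeal D⁰ K) * 1 := mul_le_mul_right h₂ _
    _ = _ := mul_one _

theorem ker_invExtension_thetaMax_empty :
    (invExtension D K (thetaMax D K ∅)).ker = ⊤ := by
  refine (Subgroup.eq_top_iff' _).mpr fun u => ?_
  rw [mem_ker_invExtension_iff]
  simp [mem_thetaMax_iff]

/-- An integral invertible ideal is trivial on `Y` if and only if no member of `Y` contains it. -/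
theorem mem_ker_invExtension_thetaMax_iff_of_coeIdeal {Y : Set (MaximalSpectrum D)}
    {u : InvGroup D K} {J : Ideal D} (hu : (u : FractionalIdeal D⁰ K) = J) :
    u ∈ (invExtension D K (thetaMax D K Y)).ker ↔ ∀ P ∈ Y, ¬ J ≤ P.asIdeal := by
  rw [mem_ker_invExtension_iff]
  constructor
  · rintro ⟨-, h⟩ P hP hJP
    have hone : (1 : K) ∈ (u : FractionalIdeal D⁰ K) * ((u⁻¹ : InvGroup D K) :
        FractionalIdeal D⁰ K) := by
      rw [Units.mul_inv]
      exact FractionalIdeal.one_mem_one _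
    have key : ∀ z ∈ (u : FractionalIdeal D⁰ K) * ((u⁻¹ : InvGroup D K) : FractionalIdeal D⁰ K),
        ∃ s ∉ P.asIdeal, ∃ a ∈ P.asIdeal, algebraMap D K s * z = algebraMap D K a := by
      intro z hz
      refine FractionalIdeal.mul_induction_on hz ?_ ?_
      · intro x hx y hy
        rw [hu, FractionalIdeal.mem_coeIdeal] at hx
        obtain ⟨b, hb, rfl⟩ := hx
        obtain ⟨s, hs, a, ha⟩ := mem_thetaMax_iff.mp (h y hy) P hP
        refine ⟨s, hs, b * a, P.asIdeal.mul_mem_right _ (hJP hb), ?_⟩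
        rw [map_mul, ← ha]
        ring
      · rintro x y ⟨s, hs, a, ha, hx⟩ ⟨t, ht, b, hb, hy⟩
        refine ⟨s * t, fun hst => (P.isMaximal.isPrime.mem_or_mem hst).elim hs ht, a * t + s * b,
          P.asIdeal.add_mem (P.asIdeal.mul_mem_right _ ha) (P.asIdeal.mul_mem_left _ hb), ?_⟩
        rw [map_add, map_mul, map_mul, map_mul, ← hx, ← hy]
        ring
    obtain ⟨s, hs, a, ha, hsa⟩ := key 1 hone
    rw [mul_one] at hsa
    exact hs (IsFractionRing.injective D K hsa ▸ ha)
  · intro h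
    refine ⟨fun x hx => ?_, fun y hy => mem_thetaMax_iff.mpr fun P hP => ?_⟩
    · rw [hu, FractionalIdeal.mem_coeIdeal] at hx
      obtain ⟨b, -, rfl⟩ := hx
      exact Subalgebra.algebraMap_mem _ b
    · obtain ⟨s, hsJ, hsP⟩ := SetLike.not_le_iff_exists.mp (h P hP)
      have hmem : algebraMap D K s * y ∈ (1 : FractionalIdeal D⁰ K) := by
        rw [← Units.mul_inv u]
        refine FractionalIdeal.mul_mem_mul ?_ hy
        rw [hu]
        exact FractionalIdeal.mem_coeIdeal_of_mem _ hsJ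
      obtain ⟨a, ha⟩ := (FractionalIdeal.mem_one_iff _).mp hmem
      exact ⟨s, hsP, a, ha.symm⟩

end Theta

/-! ### Invertible ideals of a Prüfer domain -/

section Prufer

variable {D K : Type*} [CommRing D] [IsDomain D] [Field K] [Algebra D K] [IsFractionRing D K]

/-- Divisibility at a prime of a Prüfer domain is total. -/
theorem IsPruferDomain.exists_mul_eq_or (hD : IsPruferDomain D) (P : Ideal D) [hP : P.IsPrime]
    (x y : K) : ∃ s ∉ P, ∃ a, algebraMap D K s * x = algebraMap D K a * y ∨
      algebraMap D K s * y = algebraMap D K a * x := by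
  have : ValuationRing (Localization.AtPrime P) := hD ⟨P, hP⟩
  have hinj : Function.Injective (algebraMap D (Localization.AtPrime P)) :=
    IsLocalization.injective _ P.primeCompl_le_nonZeroDivisors
  have hlift : ∀ (b c : D) (d : Localization.AtPrime P),
      algebraMap D _ b * d = algebraMap D _ c → ∃ s ∉ P, ∃ a, s * c = a * b := by
    intro b c d h
    obtain ⟨a, s, rfl⟩ := IsLocalization.exists_mk'_eq P.primeCompl d
    refine ⟨s, s.2, a, hinj ?_⟩
    rw [map_mul, ← h, mul_left_comm, IsLocalization.mk'_spec', ← map_mul, mul_comm]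
  obtain ⟨⟨b, c, d⟩, hbcd⟩ : ∃ t : D × D × D, algebraMap D K t.2.2 ≠ 0 ∧
      algebraMap D K t.2.2 * x = algebraMap D K t.1 ∧
      algebraMap D K t.2.2 * y = algebraMap D K t.2.1 := by
    obtain ⟨b, d, hd, rfl⟩ := IsFractionRing.div_surjective D x
    obtain ⟨c, e, he, rfl⟩ := IsFractionRing.div_surjective D y
    have hd' : algebraMap D K d ≠ 0 := IsFractionRing.to_map_ne_zero_of_mem_nonZeroDivisors hd
    have he' : algebraMap D K e ≠ 0 := IsFractionRing.to_map_ne_zero_of_mem_nonZeroDivisors he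
    refine ⟨(b * e, c * d, d * e), ?_, ?_, ?_⟩
    · simp [hd', he']
    · simp only [map_mul]; field_simp
    · simp only [map_mul]; field_simp
  obtain ⟨hd, hb, hc⟩ := hbcd
  obtain ⟨w, hw | hw⟩ := ValuationRing.cond (algebraMap D (Localization.AtPrime P) b)
    (algebraMap D _ c)
  · obtain ⟨s, hs, a, h⟩ := hlift b c w hw
    refine ⟨s, hs, a, Or.inr (mul_left_cancel₀ hd ?_)⟩
    rw [mul_left_comm, hc, mul_left_comm, hb, ← map_mul, h, map_mul]
  · obtain ⟨s, hs, a, h⟩ := hlift c b w hw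
    refine ⟨s, hs, a, Or.inl (mul_left_cancel₀ hd ?_)⟩
    rw [mul_left_comm, hb, mul_left_comm, hc, ← map_mul, h, map_mul]

/-- At a prime of a Prüfer domain, a finite set of fractions is divisible by one of its members. -/
theorem IsPruferDomain.exists_dvd_finset (hD : IsPruferDomain D) (P : Ideal D) [P.IsPrime]
    (S : Finset K) (hS : S.Nonempty) :
    ∃ x ∈ S, ∃ s ∉ P, ∀ y ∈ S, ∃ a, algebraMap D K s * y = algebraMap D K a * x := by
  classical
  induction hS using Finset.Nonempty.cons_induction with
  | singleton z => exact ⟨z, by simp, 1, P.one_notMem, fun y hy => ⟨1, by simp_all⟩⟩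
  | cons z S hz hS ih =>
    obtain ⟨x, hx, s, hs, h⟩ := ih
    obtain ⟨t, ht, a, hta | hta⟩ := hD.exists_mul_eq_or P x z
    · refine ⟨z, Finset.mem_cons_self z S, s * t, ‹P.IsPrime›.mul_notMem hs ht, fun y hy => ?_⟩
      rcases Finset.mem_cons.mp hy with rfl | hy
      · exact ⟨s * t, rfl⟩
      · obtain ⟨b, hb⟩ := h y hy
        refine ⟨b * a, ?_⟩
        rw [map_mul, map_mul, mul_assoc (algebraMap D K b), ← hta, mul_right_comm, hb]
        ring
    · refine ⟨x, Finset.mem_cons_of_mem hx, s * t, ‹P.IsPrime›.mul_notMem hs ht, fun y hy => ?_⟩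
      rcases Finset.mem_cons.mp hy with rfl | hy
      · exact ⟨s * a, by rw [map_mul, map_mul, mul_assoc, hta, mul_assoc]⟩
      · obtain ⟨b, hb⟩ := h y hy
        refine ⟨b * t, ?_⟩
        rw [map_mul, map_mul, mul_right_comm, hb]
        ring

/-- A nonzero finitely generated fractional ideal of a Prüfer domain is invertible, as it is
principal at every maximal ideal. -/
theorem IsPruferDomain.isUnit_of_fg (hD : IsPruferDomain D) {I : FractionalIdeal D⁰ K}
    (hI : I ≠ 0) (hfg : (I : Submodule D K).FG) : IsUnit I := by
  rw [← FractionalIdeal.mul_inv_cancel_iff_isUnit]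
  obtain ⟨J, hJ⟩ := FractionalIdeal.le_one_iff_exists_coeIdeal.mp
    (FractionalIdeal.mul_one_div_le_one (I := I))
  rw [FractionalIdeal.inv_eq, ← hJ]
  suffices J = ⊤ by rw [this, FractionalIdeal.coeIdeal_top]
  by_contra hne
  obtain ⟨P, hP, hJP⟩ := Ideal.exists_le_maximal J hne
  obtain ⟨S, hS⟩ := hfg
  have hSne : S.Nonempty := by
    rw [Finset.nonempty_iff_ne_empty]
    rintro rfl
    refine hI (FractionalIdeal.coeToSubmodule_injective ?_)
    simpa using hS.symm
  have := hP.isPrime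
  obtain ⟨x, hx, s, hs, h⟩ := hD.exists_dvd_finset P S hSne
  have hIS : ∀ y ∈ I, ∃ a, algebraMap D K s * y = algebraMap D K a * x := by
    intro y hy
    rw [← FractionalIdeal.mem_coe, ← hS] at hy
    induction hy using Submodule.span_induction with
    | mem y hy => exact h y hy
    | zero => exact ⟨0, by simp⟩
    | add y z _ _ hy hz =>
      obtain ⟨a, ha⟩ := hy
      obtain ⟨b, hb⟩ := hz
      exact ⟨a + b, by rw [mul_add, ha, hb, map_add, add_mul]⟩
    | smul c y _ hy =>
      obtain ⟨a, ha⟩ := hy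
      exact ⟨c * a, by rw [Algebra.smul_def, mul_left_comm, ha, map_mul, mul_assoc]⟩
  have hs0 : algebraMap D K s ≠ 0 := fun h0 => hs <| by
    rw [(FaithfulSMul.algebraMap_eq_zero_iff D K).mp h0]
    exact P.zero_mem
  have hx0 : x ≠ 0 := by
    rintro rfl
    refine hI (FractionalIdeal.eq_zero_iff.mpr fun y hy => ?_)
    obtain ⟨a, ha⟩ := hIS y hy
    simpa [hs0] using ha
  have hxI : x ∈ I := by
    rw [← FractionalIdeal.mem_coe, ← hS]
    exact Submodule.subset_span hx
  have hinv : algebraMap D K s * x⁻¹ ∈ 1 / I := by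
    rw [FractionalIdeal.mem_div_iff_of_ne_zero hI]
    intro y hy
    obtain ⟨a, ha⟩ := hIS y hy
    rw [mul_right_comm, ha, mul_assoc, mul_inv_cancel₀ hx0, mul_one]
    exact (FractionalIdeal.mem_one_iff _).mpr ⟨a, rfl⟩
  have hmem := FractionalIdeal.mul_mem_mul hxI hinv
  rw [mul_left_comm, mul_inv_cancel₀ hx0, mul_one, ← hJ, FractionalIdeal.mem_coeIdeal] at hmem
  obtain ⟨t, ht, hts⟩ := hmem
  exact hs (hJP (IsFractionRing.injective D K hts ▸ ht))

/-- Every invertible ideal trivial on `Y` is a quotient of integral ones: `I` is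
`(I (I + D)⁻¹) ((I + D)⁻¹)⁻¹`. -/
theorem IsPruferDomain.ker_invExtension_thetaMax_le (hD : IsPruferDomain D)
    {Y : Set (MaximalSpectrum D)} {H : Subgroup (InvGroup D K)}
    (h : ∀ u ∈ (invExtension D K (thetaMax D K Y)).ker,
      ∀ J : Ideal D, J.FG → J ≠ ⊥ → (u : FractionalIdeal D⁰ K) = J → u ∈ H) :
    (invExtension D K (thetaMax D K Y)).ker ≤ H := by
  have h' : ∀ u ∈ (invExtension D K (thetaMax D K Y)).ker,
      (u : FractionalIdeal D⁰ K) ≤ 1 → u ∈ H := by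
    intro u hu hle
    obtain ⟨J, hJ⟩ := FractionalIdeal.le_one_iff_exists_coeIdeal.mp hle
    refine h u hu J (Ideal.fg_of_isUnit (S := D⁰) (IsFractionRing.injective D K) J ?_) ?_ hJ.symm
    · rw [hJ]
      exact u.isUnit
    · rintro rfl
      exact u.ne_zero (by rw [← hJ, FractionalIdeal.coeIdeal_bot])
  intro u hu
  have hunit : IsUnit ((u : FractionalIdeal D⁰ K) + 1) := by
    refine hD.isUnit_of_fg (fun h0 => ?_) ?_
    · have : (1 : FractionalIdeal D⁰ K) ≤ u + 1 := le_add_self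
      rw [h0] at this
      exact one_ne_zero (le_antisymm this (FractionalIdeal.zero_le _))
    · rw [FractionalIdeal.coe_add]
      exact (FractionalIdeal.fg_unit u).sup (FractionalIdeal.fg_unit 1)
  obtain ⟨w, hw⟩ := hunit
  have hw₁ : ((w⁻¹ : InvGroup D K) : FractionalIdeal D⁰ K) ≤ 1 := by
    calc ((w⁻¹ : InvGroup D K) : FractionalIdeal D⁰ K)
        = (w⁻¹ : InvGroup D K) * 1 := (mul_one _).symm
      _ ≤ (w⁻¹ : InvGroup D K) * w := mul_le_mul_right (hw ▸ le_add_self) _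
      _ = 1 := Units.inv_mul w
  have hw₂ : ((u * w⁻¹ : InvGroup D K) : FractionalIdeal D⁰ K) ≤ 1 := by
    calc ((u * w⁻¹ : InvGroup D K) : FractionalIdeal D⁰ K)
        = (w⁻¹ : InvGroup D K) * u := by rw [Units.val_mul, mul_comm]
      _ ≤ (w⁻¹ : InvGroup D K) * w := mul_le_mul_right (hw ▸ le_self_add) _
      _ = 1 := Units.inv_mul w
  have hwker : w ∈ (invExtension D K (thetaMax D K Y)).ker := by
    rw [mem_ker_invExtension_iff] at hu ⊢
    have hone : ∀ x ∈ (1 : FractionalIdeal D⁰ K), x ∈ thetaMax D K Y := by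
      intro x hx
      obtain ⟨a, rfl⟩ := (FractionalIdeal.mem_one_iff _).mp hx
      exact Subalgebra.algebraMap_mem _ a
    refine ⟨fun x hx => ?_, fun x hx => hone x (hw₁ hx)⟩
    rw [hw, ← FractionalIdeal.mem_coe, FractionalIdeal.coe_add, Submodule.add_eq_sup,
      Submodule.mem_sup] at hx
    obtain ⟨y, hy, z, hz, rfl⟩ := hx
    exact add_mem (hu.1 y hy) (hone z hz)
  have h₁ := h' _ (inv_mem hwker) hw₁
  have h₂ := h' _ (mul_mem hu (inv_mem hwker)) hw₂
  have := mul_mem h₂ (inv_mem h₁)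
  rwa [inv_inv, inv_mul_cancel_right] at this

end Prufer

/-! ### The inverse topology on the maximal spectrum -/

section InverseTopology

variable {D : Type*} [CommRing D]

theorem maxInverseTopology_eq_generateFrom :
    maxInverseTopology D = TopologicalSpace.generateFrom
      (Set.range fun I : {I : Ideal D // I.FG} => {P : MaximalSpectrum D | I.1 ≤ P.asIdeal}) := by
  rw [maxInverseTopology, inverseTopology, induced_generateFrom_eq]
  congr 1
  ext U
  constructor
  · rintro ⟨_, ⟨I, hI, rfl⟩, rfl⟩
    exact ⟨⟨I, hI⟩, rfl⟩
  · rintro ⟨⟨I, hI⟩, rfl⟩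
    exact ⟨_, ⟨I, hI, rfl⟩, rfl⟩

theorem isTopologicalBasis_maxInverseTopology :
    @TopologicalSpace.IsTopologicalBasis (MaximalSpectrum D) (maxInverseTopology D)
      (Set.range fun I : {I : Ideal D // I.FG} =>
        {P : MaximalSpectrum D | I.1 ≤ P.asIdeal}) := by
  let _ := maxInverseTopology D
  refine ⟨?_, ?_, maxInverseTopology_eq_generateFrom⟩
  · rintro _ ⟨I, rfl⟩ _ ⟨J, rfl⟩ P ⟨hI, hJ⟩
    exact ⟨_, ⟨⟨I.1 ⊔ J.1, Submodule.FG.sup I.2 J.2⟩, rfl⟩, (sup_le hI hJ : I.1 ⊔ J.1 ≤ P.asIdeal),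
      fun Q (hQ : I.1 ⊔ J.1 ≤ Q.asIdeal) => sup_le_iff.mp hQ⟩
  · refine Set.eq_univ_of_forall fun P => ⟨_, ⟨⟨⊥, Submodule.fg_bot⟩, rfl⟩, ?_⟩
    exact bot_le (a := P.asIdeal)

theorem isOpen_maxInverseTopology_of_fg {I : Ideal D} (hI : I.FG) :
    @IsOpen (MaximalSpectrum D) (maxInverseTopology D) {P | I ≤ P.asIdeal} := by
  let _ := maxInverseTopology D
  exact isTopologicalBasis_maxInverseTopology.isOpen ⟨⟨I, hI⟩, rfl⟩

/-- An ultrafilter containing `{P | I ≤ P}` converges to the prime ideal of the elements that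
belong to almost all `P`; it is maximal as it contains `I ≠ ⊥`. -/
theorem isCompact_maxInverseTopology [IsDomain D] [Ring.KrullDimLE 1 D] {I : Ideal D}
    (hI : I ≠ ⊥) :
    @IsCompact (MaximalSpectrum D) (maxInverseTopology D) {P | I ≤ P.asIdeal} := by
  let _ := maxInverseTopology D
  rw [isCompact_iff_ultrafilter_le_nhds']
  intro F hF
  let Q : Ideal D :=
    { carrier := {a | ∀ᶠ P in (F : Filter (MaximalSpectrum D)), a ∈ P.asIdeal}
      add_mem' := fun ha hb => by
        filter_upwards [ha, hb] with P h₁ h₂ using P.asIdeal.add_mem h₁ h₂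
      zero_mem' := Filter.Eventually.of_forall fun P => P.asIdeal.zero_mem
      smul_mem' := fun c a ha => by
        filter_upwards [ha] with P h using P.asIdeal.mul_mem_left c h }
  have hQ : ∀ a, a ∈ Q ↔ ∀ᶠ P in (F : Filter (MaximalSpectrum D)), a ∈ P.asIdeal :=
    fun _ => Iff.rfl
  have hprime : Q.IsPrime := by
    refine ⟨fun h => ?_, fun {a b} hab => ?_⟩
    · obtain ⟨P, hP⟩ := ((hQ 1).mp (h ▸ Submodule.mem_top)).exists
      exact P.isMaximal.isPrime.one_notMem hP
    · rw [hQ, hQ, ← Ultrafilter.eventually_or]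
      filter_upwards [(hQ _).mp hab] with P h using P.isMaximal.isPrime.mem_or_mem h
  have hIQ : I ≤ Q := fun a ha => by
    filter_upwards [hF] with P hP using hP ha
  have hmax : Q.IsMaximal := hprime.isMaximal_of_ne_bot fun h => hI (le_bot_iff.mp (h ▸ hIQ))
  refine ⟨⟨Q, hmax⟩, hIQ, ?_⟩
  rw [maxInverseTopology_eq_generateFrom, TopologicalSpace.nhds_generateFrom]
  refine le_iInf₂ fun U hU => ?_
  obtain ⟨hQU, ⟨J, S, hS⟩, rfl⟩ := hU
  rw [Filter.le_principal_iff]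
  have hall : ∀ᶠ P in (F : Filter (MaximalSpectrum D)), ∀ a ∈ S, a ∈ P.asIdeal :=
    (Filter.eventually_all_finset S).mpr fun a ha =>
      (hQ a).mp (hQU (hS ▸ Ideal.subset_span ha))
  filter_upwards [hall] with P hP
  rw [← hS]
  exact Ideal.span_le.mpr hP

/-- In dimension one, a clopen part of the set of maximal ideals containing a nonzero finitely
generated ideal is cut out by a finitely generated ideal. -/
theorem exists_fg_le_iff_of_isClopen [IsDomain D] [Ring.KrullDimLE 1 D] {I : Ideal D}
    (hfg : I.FG) (hI : I ≠ ⊥) {A : Set (MaximalSpectrum D)}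
    (hA : @IsClopen (MaximalSpectrum D) (maxInverseTopology D) A) :
    ∃ L : Ideal D, L.FG ∧ ∀ P : MaximalSpectrum D, L ≤ P.asIdeal ↔ I ≤ P.asIdeal ∧ P ∈ A := by
  let _ := maxInverseTopology D
  obtain ⟨s, hs, h⟩ := eq_finite_iUnion_of_isTopologicalBasis_of_isCompact_open _
    isTopologicalBasis_maxInverseTopology ({P | I ≤ P.asIdeal} ∩ A)
    ((isCompact_maxInverseTopology hI).inter_right hA.isClosed)
    ((isOpen_maxInverseTopology_of_fg hfg).inter hA.isOpen)
  refine ⟨∏ J ∈ hs.toFinset, J.1, ?_, fun P => ?_⟩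
  · refine Finset.prod_induction _ (fun J : Ideal D => J.FG) (fun _ _ => Submodule.FG.mul) ?_
      fun J _ => J.2
    exact Ideal.one_eq_top (R := D) ▸ Ideal.fg_top D
  · rw [P.isMaximal.isPrime.prod_le]
    have := Set.ext_iff.mp h P
    simp only [Set.mem_inter_iff, Set.mem_ofPred_eq, Set.mem_iUnion] at this
    rw [this]
    simp

end InverseTopology

/-! ### Splitting along clopen sets -/

section Splitting

variable {D K : Type*} [CommRing D] [IsDomain D] [Field K] [Algebra D K] [IsFractionRing D K]

/-- Every invertible ideal is a product of an ideal trivial on a given clopen set and one trivial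
off it. For a finitely generated integral ideal `I`, choose finitely generated `L` and `L'` cutting
out the parts inside and outside `A` of the set of maximal ideals containing `I`. Then
`(L L') ^ n ≤ I` for some `n`, and `I + L ^ n` agrees with `I` on `A` and is trivial off `A`. -/
theorem IsPruferDomain.ker_sup_ker_compl_eq_top [Ring.KrullDimLE 1 D] (hD : IsPruferDomain D)
    {A : Set (MaximalSpectrum D)}
    (hA : @IsClopen (MaximalSpectrum D) (maxInverseTopology D) A) :
    (invExtension D K (thetaMax D K A)).ker ⊔ (invExtension D K (thetaMax D K Aᶜ)).ker = ⊤ := by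
  rw [eq_top_iff, ← ker_invExtension_thetaMax_empty]
  refine hD.ker_invExtension_thetaMax_le fun u _ I hfg hI hu => ?_
  obtain ⟨L, hL, hLA⟩ := exists_fg_le_iff_of_isClopen hfg hI hA
  obtain ⟨L', hL', hLA'⟩ := exists_fg_le_iff_of_isClopen hfg hI
    (@IsClopen.compl _ (maxInverseTopology D) _ hA)
  have hrad : L * L' ≤ I.radical := by
    rw [Ideal.radical_eq_sInf]
    refine le_sInf fun P ⟨hIP, hP⟩ => ?_
    have hmax : P.IsMaximal := hP.isMaximal_of_ne_bot fun h => hI (le_bot_iff.mp (h ▸ hIP))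
    by_cases hPA : (⟨P, hmax⟩ : MaximalSpectrum D) ∈ A
    · exact Ideal.mul_le_left.trans ((hLA ⟨P, hmax⟩).mpr ⟨hIP, hPA⟩)
    · exact Ideal.mul_le_right.trans ((hLA' ⟨P, hmax⟩).mpr ⟨hIP, hPA⟩)
  obtain ⟨n, hn⟩ := Ideal.exists_pow_le_of_le_radical_of_fg hrad (Submodule.FG.mul hL hL')
  rw [mul_pow] at hn
  have hJ : I ⊔ L ^ n ≠ ⊥ := fun h => hI (le_bot_iff.mp (h ▸ le_sup_left))
  have hJfg : (((I ⊔ L ^ n : Ideal D) : FractionalIdeal D⁰ K) : Submodule D K).FG := by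
    rw [FractionalIdeal.coeIdeal_fg D⁰ (IsFractionRing.injective D K)]
    exact Submodule.FG.sup hfg (Submodule.FG.pow hL n)
  obtain ⟨v, hv⟩ := hD.isUnit_of_fg (FractionalIdeal.coeIdeal_ne_zero.mpr hJ) hJfg
  have hvA : v ∈ (invExtension D K (thetaMax D K Aᶜ)).ker := by
    refine (mem_ker_invExtension_thetaMax_iff_of_coeIdeal hv).mpr fun P hP hle => hP ?_
    exact ((hLA P).mp (P.isMaximal.isPrime.le_of_pow_le (le_sup_right.trans hle))).2
  have hone : ∀ x ∈ (1 : FractionalIdeal D⁰ K), x ∈ thetaMax D K A := by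
    intro x hx
    obtain ⟨a, rfl⟩ := (FractionalIdeal.mem_one_iff _).mp hx
    exact Subalgebra.algebraMap_mem _ a
  have huv : v * u⁻¹ ∈ (invExtension D K (thetaMax D K A)).ker := by
    rw [mem_ker_invExtension_iff]
    constructor
    · intro z hz
      rw [Units.val_mul] at hz
      refine FractionalIdeal.mul_induction_on hz ?_ fun _ _ => add_mem
      intro x hx y hy
      rw [hv, FractionalIdeal.mem_coeIdeal] at hx
      obtain ⟨b, hb, rfl⟩ := hx
      have hIy : ∀ c ∈ I, algebraMap D K c * y ∈ (1 : FractionalIdeal D⁰ K) := by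
        intro c hc
        rw [← Units.mul_inv u]
        refine FractionalIdeal.mul_mem_mul ?_ hy
        rw [hu]
        exact FractionalIdeal.mem_coeIdeal_of_mem _ hc
      rw [mem_thetaMax_iff]
      intro P hP
      have hL'P : ¬ L' ^ n ≤ P.asIdeal := fun hle =>
        ((hLA' P).mp (P.isMaximal.isPrime.le_of_pow_le hle)).2 hP
      obtain ⟨s, hsL, hsP⟩ := SetLike.not_le_iff_exists.mp hL'P
      have hsb : s * b ∈ I := by
        obtain ⟨c, hc, d, hd, rfl⟩ := Submodule.mem_sup.mp hb
        rw [mul_add]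
        exact I.add_mem (I.mul_mem_left _ hc) (hn (mul_comm s d ▸ Ideal.mul_mem_mul hd hsL))
      obtain ⟨a, ha⟩ := (FractionalIdeal.mem_one_iff _).mp (hIy _ hsb)
      exact ⟨s, hsP, a, by rw [ha, map_mul, mul_assoc]⟩
    · intro x hx
      refine hone x ?_
      rw [mul_inv_rev, inv_inv, Units.val_mul] at hx
      rw [← Units.mul_inv v]
      refine mul_le_mul_left (?_ : (u : FractionalIdeal D⁰ K) ≤ v) _ hx
      rw [hu, hv, FractionalIdeal.coeIdeal_le_coeIdeal]
      exact le_sup_left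
  have : u = (v * u⁻¹)⁻¹ * v := by group
  rw [this]
  exact Subgroup.mul_mem_sup (inv_mem huv) hvA

/-- An invertible ideal trivial off a union of clopen sets is a quotient of integral ideals, each of
which is trivial off finitely many of them by compactness. The clopen sets then split off one by one. -/
theorem IsPruferDomain.ker_compl_iUnion_eq_iSup [Ring.KrullDimLE 1 D] (hD : IsPruferDomain D)
    {B : ℕ → Set (MaximalSpectrum D)}
    (hB : ∀ n, @IsClopen (MaximalSpectrum D) (maxInverseTopology D) (B n)) :
    (invExtension D K (thetaMax D K (⋃ n, B n)ᶜ)).ker =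
      ⨆ n, (invExtension D K (thetaMax D K (B n)ᶜ)).ker := by
  let _ := maxInverseTopology D
  refine le_antisymm ?_ (iSup_le fun n => ker_invExtension_thetaMax_anti
    (Set.compl_subset_compl.mpr (Set.subset_iUnion B n)))
  have hfin : ∀ t : Finset ℕ, (invExtension D K (thetaMax D K (⋃ n ∈ t, B n)ᶜ)).ker ≤
      ⨆ n, (invExtension D K (thetaMax D K (B n)ᶜ)).ker := by
    intro t
    induction t using Finset.induction_on with
    | empty =>
      have hempty : (⋃ n ∈ (∅ : Finset ℕ), B n)ᶜ = Set.univ := by simp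
      rw [hempty, ker_invExtension_thetaMax_univ]
      exact bot_le
    | insert m t hm ih =>
      intro u hu
      set C : Set (MaximalSpectrum D) := ⋃ n ∈ t, B n with hC
      rw [Finset.set_biUnion_insert] at hu
      have hCclopen : IsClopen C := t.finite_toSet.isClopen_biUnion fun n _ => hB n
      obtain ⟨a, ha, b, hb, rfl⟩ := Subgroup.mem_sup.mp
        (hD.ker_sup_ker_compl_eq_top (K := K) hCclopen ▸ Subgroup.mem_top u)
      refine mul_mem ?_ (ih hb)
      have hsub : (B m ∪ C)ᶜ ⊆ Cᶜ := Set.compl_subset_compl.mpr Set.subset_union_right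
      have ha' : a ∈ (invExtension D K (thetaMax D K (B m ∪ C)ᶜ)).ker := by
        have := mul_mem hu (inv_mem (ker_invExtension_thetaMax_anti hsub hb))
        rwa [mul_inv_cancel_right] at this
      refine Subgroup.mem_iSup_of_mem m
        (ker_invExtension_thetaMax_anti ?_ (ker_invExtension_thetaMax_inf_le _ _ ⟨ha, ha'⟩))
      intro P hP
      by_cases hPC : P ∈ C
      · exact Or.inl hPC
      · exact Or.inr fun h => h.elim hP hPC
  refine hD.ker_invExtension_thetaMax_le fun u hu J hfg hJ huJ => ?_
  rw [mem_ker_invExtension_thetaMax_iff_of_coeIdeal huJ] at hu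
  obtain ⟨t, ht⟩ := (isCompact_maxInverseTopology hJ).elim_finite_subcover B
    (fun n => (hB n).isOpen) fun P hP => by
      by_contra h
      exact hu P h hP
  exact hfin t ((mem_ker_invExtension_thetaMax_iff_of_coeIdeal huJ).mpr fun P hP hle => hP (ht hle))

theorem iSupIndep_ker_invExtension_compl {ι : Type*} {B : ι → Set (MaximalSpectrum D)}
    (hB : Pairwise (Function.onFun Disjoint B)) :
    iSupIndep fun n => (invExtension D K (thetaMax D K (B n)ᶜ)).ker := by
  intro n
  have hle : ⨆ (m) (_ : m ≠ n), (invExtension D K (thetaMax D K (B m)ᶜ)).ker ≤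
      (invExtension D K (thetaMax D K (B n))).ker :=
    iSup₂_le fun m hm => ker_invExtension_thetaMax_anti (hB hm).subset_compl_left
  refine Disjoint.mono_right hle (disjoint_iff_inf_le.mpr ?_)
  refine (ker_invExtension_thetaMax_inf_le _ _).trans ?_
  rw [Set.compl_union_self, ker_invExtension_thetaMax_univ]

/-- Invertible ideals trivial off a subset of `A` are determined by their extension to `Θ(A)`. -/
theorem isFreeAbelian_ker_invExtension_compl {A B : Set (MaximalSpectrum D)} (hBA : B ⊆ A)
    (hA : IsFreeAbelian (InvGroup (thetaMax D K A) K)) :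
    IsFreeAbelian (invExtension D K (thetaMax D K Bᶜ)).ker := by
  refine hA.of_injective
    ((invExtension D K (thetaMax D K A)).comp (Subgroup.subtype _)) ?_
  refine (injective_iff_map_eq_one _).mpr fun u hu => Subtype.ext ?_
  have h := ker_invExtension_thetaMax_inf_le A Bᶜ ⟨hu, u.2⟩
  have huniv : A ∪ Bᶜ = Set.univ :=
    Set.univ_subset_iff.mp (Set.union_compl_self B ▸ Set.union_subset_union_left _ hBA)
  rwa [huniv, ker_invExtension_thetaMax_univ, Subgroup.mem_bot] at h

end Splitting

theorem theorem4p12 (D K : Type*) [CommRing D] [IsDomain D] [Field K] [Algebra D K]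
    [IsFractionRing D K] (hPrufer : IsPruferDomain D) (hdim : ringKrullDim D = 1)
    {ι : Type*} [Countable ι] (A : ι → Set (MaximalSpectrum D))
    (hA : ∀ n, @IsClopen (MaximalSpectrum D) (maxInverseTopology D) (A n))
    (hfree : ∀ n, IsFreeAbelian (InvGroup (thetaMax D K (A n)) K)) :
    IsFreeAbelian (invExtension D K (thetaMax D K (⋃ n, A n)ᶜ)).ker := by
  let _ := maxInverseTopology D
  have : Ring.KrullDimLE 1 D := Ring.krullDimLE_iff.mpr hdim.le
  cases isEmpty_or_nonempty ι
  · rw [Set.iUnion_of_empty, Set.compl_empty, ker_invExtension_thetaMax_univ]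
    exact Module.Free.of_subsingleton ℤ _
  obtain ⟨f, hf⟩ := exists_surjective_nat ι
  have hB : ∀ n, IsClopen (disjointed (A ∘ f) n) := fun n =>
    disjointedRec (fun _ _ h => h.diff (hA _)) (hA (f n))
  rw [← hf.iUnion_comp A, ← Function.comp_def A f, ← iUnion_disjointed,
    hPrufer.ker_compl_iUnion_eq_iSup hB]
  exact IsFreeAbelian.iSup_of_iSupIndep
    (fun n => isFreeAbelian_ker_invExtension_compl (disjointed_le (A ∘ f) n) (hfree (f n)))
    (iSupIndep_ker_invExtension_compl (disjoint_disjointed (A ∘ f)))
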